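/- Let $X$ be a Tychonoff space (that is, completely regular and Hausdorff) that is pseudocompact, i.e. every continuous function $f:X\to\mathbb{R}$ is bounded. A zero-set of $X$ is a set of the form $f^{-1}(0)$ with $f:X\to\mathbb{R}$ continuous, and a cozero-set is the complement of a zero-set. The space $X$ is called a $Q_f$-space if every subset of $X$ is both a countable union of zero-sets and a countable intersection of cozero-sets. Then $X$ is a $Q_f$-space if and only if $X$ is countable (possibly finite), metrizable and compact. -/

import Mathlib

/-- A zero-set: the preimage of `0` under a continuous real-valued function. -/
def IsZeroSet {X : Type*} [TopologicalSpace X] (A : Set X) : Prop :=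
  ∃ f : X → ℝ, Continuous f ∧ A = f ⁻¹' {0}

/-- A cozero-set (functionally open set): the complement of a zero-set. -/
def IsCozeroSet {X : Type*} [TopologicalSpace X] (B : Set X) : Prop :=
  ∃ A : Set X, IsZeroSet A ∧ B = Aᶜ

/-- A countable union of zero-sets. -/
def IsZerSigma {X : Type*} [TopologicalSpace X] (A : Set X) : Prop :=
  ∃ Z : ℕ → Set X, (∀ n, IsZeroSet (Z n)) ∧ A = ⋃ n, Z n

/-- A countable intersection of cozero-sets. -/
def IsCozDelta {X : Type*} [TopologicalSpace X] (A : Set X) : Prop :=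
  ∃ U : ℕ → Set X, (∀ n, IsCozeroSet (U n)) ∧ A = ⋂ n, U n

/-- A `CZ`-set: a set that is both a countable union of zero-sets and a countable intersection
of cozero-sets. -/
def IsCZSet {X : Type*} [TopologicalSpace X] (A : Set X) : Prop :=
  IsZerSigma A ∧ IsCozDelta A

/-- A `Q_f`-space: every subset is a `CZ`-set. -/
def IsQfSpace (X : Type*) [TopologicalSpace X] : Prop :=
  ∀ A : Set X, IsCZSet A

/-- Every continuous real-valued function is bounded (for Tychonoff spaces, this is
pseudocompactness). -/
def IsPseudocompactSpace (X : Type*) [TopologicalSpace X] : Prop :=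
  ∀ f : X → ℝ, Continuous f → ∃ C : ℝ, ∀ x, |f x| ≤ C

section PseudocompactImages

open Set Filter Topology

variable {X : Type*} [TopologicalSpace X]

/-! Pseudocompactness makes continuous images of zero-sets in metric spaces closed
(`IsZeroSet.isClosed_image`). In a `Q_f`-space this forces every continuous Polish-valued map to
have countable range: otherwise its closed range contains a Cantor set, all of whose subsets would
be F_σ.

Suppose such an `X` is uncountable. If clopen sets split every uncountable set into two uncountable
pieces, a binary tree of splittings would map `X` continuously onto the Cantor space. So some
uncountable `W` is unsplittable. Yet `W` contains two disjoint uncountable zero-sets, and a real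
function separating them omits a value in (0, 1), which yields a clopen splitting of `W`.

A countable Tychonoff `X` injects continuously into a countable power of the line; closed ranges
make it compact, so the injection is an embedding. -/

lemma isZeroSet_univ : IsZeroSet (univ : Set X) :=
  ⟨fun _ => 0, continuous_const, by ext; simp⟩

/-- Every continuous metric-valued map on a pseudocompact space sends zero-sets to closed sets. -/
lemma IsZeroSet.isClosed_image (hX : IsPseudocompactSpace X) {M : Type*} [MetricSpace M]
    {h : X → M} (hh : Continuous h) {Z : Set X} (hZ : IsZeroSet Z) : IsClosed (h '' Z) := by
  obtain ⟨f, hf, rfl⟩ := hZ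
  refine isClosed_of_closure_subset fun p hp => ?_
  by_contra hpn
  -- If `p` were a missed limit point, the reciprocal of this positive function would be continuous
  -- and unbounded on the zero-set.
  have hpos : ∀ x, 0 < dist (h x) p + |f x| := by
    intro x
    rcases eq_or_ne (f x) 0 with h0 | h0
    · have : h x ≠ p := fun e => hpn ⟨x, h0, e⟩
      have := dist_pos.2 this
      positivity
    · have := abs_pos.2 h0
      positivity
  obtain ⟨C, hC⟩ := hX (fun x => (dist (h x) p + |f x|)⁻¹)
    (((hh.dist continuous_const).add hf.abs).inv₀ fun x => (hpos x).ne')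
  have hC' : ∀ x, 1 ≤ max C 1 * (dist (h x) p + |f x|) := by
    intro x
    have h1 := (le_abs_self _).trans ((hC x).trans (le_max_left C 1))
    rwa [inv_le_iff_one_le_mul₀ (hpos x)] at h1
  have hm : 0 < max C 1 := lt_max_of_lt_right one_pos
  obtain ⟨_, ⟨x, hx, rfl⟩, hd⟩ := Metric.mem_closure_iff.1 hp (max C 1)⁻¹ (inv_pos.2 hm)
  have h2 := hC' x
  rw [show f x = 0 from hx, abs_zero, add_zero, dist_comm] at h2
  have h3 := mul_lt_mul_of_pos_left hd hm
  rw [mul_inv_cancel₀ hm.ne'] at h3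
  linarith

lemma isClosed_range_of_isPseudocompactSpace (hX : IsPseudocompactSpace X) {M : Type*}
    [MetricSpace M] {h : X → M} (hh : Continuous h) : IsClosed (range h) := by
  rw [← image_univ]
  exact isZeroSet_univ.isClosed_image hX hh

end PseudocompactImages

section CantorSpace

open Set Filter Topology

lemma interior_singleton_nat_bool (x : ℕ → Bool) : interior ({x} : Set (ℕ → Bool)) = ∅ := by
  rw [eq_empty_iff_forall_notMem]
  intro y hy
  have hyx : x = y := (mem_singleton_iff.1 (interior_subset hy)).symm
  subst hyx
  have ht : Tendsto (fun n : ℕ => Function.update x n (!x n)) atTop (𝓝 x) := by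
    rw [tendsto_pi_nhds]
    intro i
    refine tendsto_const_nhds.congr' ?_
    filter_upwards [eventually_gt_atTop i] with n hn
    rw [Function.update_of_ne hn.ne]
  obtain ⟨n, hn⟩ := (ht.eventually (mem_interior_iff_mem_nhds.1 hy)).exists
  have := congrFun (show Function.update x n (!x n) = x from hn) n
  simp at this

/-- The Cantor space has a subset that is not a countable union of closed sets. -/
lemma exists_ne_iUnion_isClosed_nat_bool :
    ∃ D : Set (ℕ → Bool), ∀ F : ℕ → Set (ℕ → Bool), (∀ n, IsClosed (F n)) → D ≠ ⋃ n, F n := by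
  obtain ⟨D, hDc, hDd⟩ := TopologicalSpace.exists_countable_dense (ℕ → Bool)
  -- Baire: the closed pieces of `Dᶜ` miss a dense set and points are not open, so all have empty
  -- interior, yet together they cover.
  refine ⟨Dᶜ, fun F hF hDF => ?_⟩
  have : Countable D := hDc.to_subtype
  obtain ⟨i, y, hi⟩ := nonempty_interior_of_iUnion_of_closed
    (f := (Sum.elim F (fun d : D => {(d : ℕ → Bool)}) : ℕ ⊕ D → Set (ℕ → Bool)))
    (by rintro (n | d) <;> simp [hF]) (by
      rw [iUnion_sum]
      simp only [Sum.elim_inl, Sum.elim_inr]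
      rw [← hDF, iUnion_coe_set]
      simp)
  rcases i with n | d
  · obtain ⟨z, hz, hzD⟩ := hDd.inter_open_nonempty _ isOpen_interior ⟨y, hi⟩
    have : z ∈ Dᶜ := hDF ▸ mem_iUnion.2 ⟨n, interior_subset hz⟩
    exact this hzD
  · simp [interior_singleton_nat_bool] at hi

end CantorSpace

section SplittingTree

open Set Topology

variable {X : Type*}

/-- The cell of `x` at level `n` of the binary tree of sets obtained by repeatedly
splitting a set `W` along `E W`. -/
def splittingCell (E : Set X → Set X) (x : X) : ℕ → Set X
  | 0 => univ
  | n + 1 => {y ∈ splittingCell E x n |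
      y ∈ E (splittingCell E x n) ↔ x ∈ E (splittingCell E x n)}

lemma mem_splittingCell_self (E : Set X → Set X) (x : X) (n : ℕ) : x ∈ splittingCell E x n := by
  induction n with
  | zero => trivial
  | succ n ih => exact ⟨ih, Iff.rfl⟩

lemma splittingCell_eq_of_mem {E : Set X → Set X} {x y : X} {n : ℕ}
    (hy : y ∈ splittingCell E x n) : splittingCell E y n = splittingCell E x n := by
  induction n with
  | zero => rfl
  | succ n ih => simp only [splittingCell, ih hy.1, hy.2]

lemma splittingCell_subset (E : Set X → Set X) (x : X) {m n : ℕ} (h : m ≤ n) :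
    splittingCell E x n ⊆ splittingCell E x m := by
  induction n, h using Nat.le_induction with
  | base => exact subset_rfl
  | succ n _ ih => exact fun y hy => ih hy.1

open Classical in
/-- The branch of `x` in the binary tree of splittings. -/
noncomputable def splittingBranch (E : Set X → Set X) (x : X) (n : ℕ) : Bool :=
  decide (x ∈ E (splittingCell E x n))

lemma splittingBranch_eq_of_mem {E : Set X → Set X} {x y : X} {n : ℕ}
    (hy : y ∈ splittingCell E x (n + 1)) : splittingBranch E y n = splittingBranch E x n := by
  simp [splittingBranch, splittingCell_eq_of_mem hy.1, hy.2]

end SplittingTree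

section QfSpaces

open Set Filter Topology

variable {X : Type*} [TopologicalSpace X]

/-- Pull a bad subset of a Cantor set in the range back to `X`, write it as a union of zero-sets,
and push these forward to closed sets. -/
lemma IsQfSpace.countable_range (hQ : IsQfSpace X) (hX : IsPseudocompactSpace X) {M : Type*}
    [TopologicalSpace M] [PolishSpace M] {h : X → M} (hh : Continuous h) :
    (range h).Countable := by
  let := TopologicalSpace.upgradeIsCompletelyMetrizable M
  by_contra hunc
  obtain ⟨φ, hφr, hφ, hφi⟩ :=
    (isClosed_range_of_isPseudocompactSpace hX hh).exists_nat_bool_injection_of_not_countable hunc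
  obtain ⟨D, hD⟩ := exists_ne_iUnion_isClosed_nat_bool
  obtain ⟨Z, hZ, hZe⟩ := (hQ (h ⁻¹' (φ '' D))).1
  refine hD (fun n => φ ⁻¹' (h '' Z n)) (fun n => ((hZ n).isClosed_image hX hh).preimage hφ) ?_
  rw [← preimage_iUnion, ← image_iUnion, ← hZe, image_preimage_eq_inter_range,
    inter_eq_left.2 ((image_subset_range _ _).trans hφr), hφi.preimage_image]

lemma isClopen_splittingCell {E : Set X → Set X} (hE : ∀ W, IsClopen (E W)) (x : X) (n : ℕ) :
    IsClopen (splittingCell E x n) := by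
  induction n with
  | zero => exact isClopen_univ
  | succ n ih =>
    by_cases hx : x ∈ E (splittingCell E x n)
    · simp only [splittingCell, hx, iff_true]
      exact ih.inter (hE _)
    · simp only [splittingCell, hx, iff_false]
      exact ih.diff (hE _)

lemma continuous_splittingBranch {E : Set X → Set X} (hE : ∀ W, IsClopen (E W)) :
    Continuous (splittingBranch E) := by
  refine continuous_pi fun n => IsLocallyConstant.continuous ?_
  rw [IsLocallyConstant.iff_exists_open]
  exact fun x => ⟨_, (isClopen_splittingCell hE x (n + 1)).isOpen,
    mem_splittingCell_self E x _, fun y hy => splittingBranch_eq_of_mem hy⟩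

/-- If every uncountable clopen set can be split, all finite branches occur. -/
lemma exists_splittingBranch_eq {E : Set X → Set X} (hE : ∀ W, IsClopen (E W))
    (huniv : ¬(univ : Set X).Countable)
    (hsplit : ∀ W, IsClopen W → ¬W.Countable → ¬(W ∩ E W).Countable ∧ ¬(W \ E W).Countable)
    (b : ℕ → Bool) (n : ℕ) :
    ∃ x, ¬(splittingCell E x n).Countable ∧ ∀ i < n, splittingBranch E x i = b i := by
  induction n with
  | zero =>
    obtain ⟨x, -⟩ := Set.Infinite.nonempty fun h0 => huniv h0.countable
    exact ⟨x, huniv, by simp⟩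
  | succ n ih =>
    obtain ⟨x, hx, hb⟩ := ih
    obtain ⟨h1, h2⟩ := hsplit _ (isClopen_splittingCell hE x n) hx
    have key : ∃ y ∈ splittingCell E x n, ¬(splittingCell E y (n + 1)).Countable ∧
        splittingBranch E y n = b n := by
      cases hbn : b n with
      | true =>
        obtain ⟨y, hy⟩ := Set.Infinite.nonempty fun h0 => h1 h0.countable
        refine ⟨y, hy.1, ?_, ?_⟩
        · simp only [splittingCell, splittingCell_eq_of_mem hy.1, hy.2, iff_true]
          exact h1
        · simp only [splittingBranch, splittingCell_eq_of_mem hy.1, hy.2, decide_true]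
      | false =>
        obtain ⟨y, hy⟩ := Set.Infinite.nonempty fun h0 => h2 h0.countable
        refine ⟨y, hy.1, ?_, ?_⟩
        · simp only [splittingCell, splittingCell_eq_of_mem hy.1, hy.2, iff_false]
          exact h2
        · simp only [splittingBranch, splittingCell_eq_of_mem hy.1, hy.2, decide_false]
    obtain ⟨y, hy, hyc, hyb⟩ := key
    refine ⟨y, hyc, fun i hi => ?_⟩
    rcases Nat.lt_succ_iff_lt_or_eq.1 hi with hi | rfl
    · rw [splittingBranch_eq_of_mem (splittingCell_subset E x hi hy), hb i hi]
    · exact hyb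

/-- In an uncountable pseudocompact `Q_f`-space, some uncountable clopen set cannot be split into
two uncountable pieces by a clopen set. -/
lemma IsQfSpace.exists_unsplittable (hQ : IsQfSpace X) (hX : IsPseudocompactSpace X)
    (huniv : ¬(univ : Set X).Countable) :
    ∃ W : Set X, ¬W.Countable ∧ ∀ E, IsClopen E → (W ∩ E).Countable ∨ (W \ E).Countable := by
  by_contra! hcon
  have hex : ∀ W : Set X, ∃ E, IsClopen E ∧
      (¬W.Countable → ¬(W ∩ E).Countable ∧ ¬(W \ E).Countable) := by
    intro W
    by_cases hW : W.Countable
    · exact ⟨univ, isClopen_univ, fun h => (h hW).elim⟩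
    · obtain ⟨E, hE, h⟩ := hcon W hW
      exact ⟨E, hE, fun _ => h⟩
  choose E hE hsplit using hex
  have hcont := continuous_splittingBranch hE
  have hclosed : IsClosed (range (splittingBranch E)) := by
    let := TopologicalSpace.metrizableSpaceMetric (ℕ → Bool)
    exact isClosed_range_of_isPseudocompactSpace hX hcont
  have hrange : range (splittingBranch E) = univ := by
    refine eq_univ_of_forall fun b => ?_
    -- Points realizing ever longer prefixes of `b` have branches converging to `b`, and the range
    -- is closed.
    choose x _ hx using exists_splittingBranch_eq hE huniv (fun W _ => hsplit W) b
    refine hclosed.mem_of_tendsto (f := fun n => splittingBranch E (x n)) (b := atTop) ?_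
      (Eventually.of_forall fun n => mem_range_self _)
    rw [tendsto_pi_nhds]
    intro i
    refine tendsto_const_nhds.congr' ?_
    filter_upwards [eventually_gt_atTop i] with n hn
    exact (hx n i hn).symm
  have : PolishSpace (ℕ → Bool) := by
    let := TopologicalSpace.metrizableSpaceMetric (ℕ → Bool)
    infer_instance
  have hcard : Cardinal.mk (ℕ → Bool) = 2 ^ Cardinal.aleph0 := by simp
  have hc := hQ.countable_range hX hcont
  rw [hrange, countable_univ_iff] at hc
  exact (Cardinal.cantor Cardinal.aleph0).not_ge (hcard ▸ Cardinal.mk_le_aleph0_iff.2 hc)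

/-- One of countably many zero-sets with uncountable union must be uncountable. -/
lemma IsQfSpace.exists_uncountable_isZeroSet (hQ : IsQfSpace X) {B : Set X}
    (hB : ¬B.Countable) : ∃ Z ⊆ B, IsZeroSet Z ∧ ¬Z.Countable := by
  obtain ⟨Z, hZ, rfl⟩ := (hQ B).1
  have : ∃ n, ¬(Z n).Countable := by
    by_contra! h
    exact hB (countable_iUnion h)
  obtain ⟨n, hn⟩ := this
  exact ⟨Z n, subset_iUnion Z n, hZ n, hn⟩

/-- In a pseudocompact `Q_f`-space, disjoint zero-sets are separated by a clopen set. -/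
lemma IsQfSpace.exists_isClopen_separating (hQ : IsQfSpace X) (hX : IsPseudocompactSpace X)
    {Z Z' : Set X} (hZ : IsZeroSet Z) (hZ' : IsZeroSet Z') (hd : Disjoint Z Z') :
    ∃ E, IsClopen E ∧ Z ⊆ E ∧ Disjoint Z' E := by
  obtain ⟨f, hf, rfl⟩ := hZ
  obtain ⟨g, hg, rfl⟩ := hZ'
  have hne : ∀ x, |f x| + |g x| ≠ 0 := by
    intro x h0
    have h1 := abs_nonneg (f x)
    have h2 := abs_nonneg (g x)
    exact disjoint_left.1 hd (show f x = 0 from abs_eq_zero.1 (by linarith))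
      (show g x = 0 from abs_eq_zero.1 (by linarith))
  set k : X → ℝ := fun x => |f x| / (|f x| + |g x|) with hk
  have hkc : Continuous k := hf.abs.div (hf.abs.add hg.abs) hne
  -- `k` is 0 on the first zero-set and 1 on the second; cutting at an omitted value gives a clopen
  -- set.
  obtain ⟨r, hr, hrk⟩ : ∃ r ∈ Ioo (0 : ℝ) 1, r ∉ range k := by
    by_contra! h
    exact Cardinal.Real.Ioo_countable_iff.not.2 (by norm_num)
      ((hQ.countable_range hX hkc).mono h)
  refine ⟨{x | k x < r}, ⟨?_, isOpen_lt hkc continuous_const⟩, fun x hx => ?_, ?_⟩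
  · have : {x | k x < r} = {x | k x ≤ r} := by
      ext x
      exact ⟨fun h => le_of_lt (show k x < r from h), fun h => lt_of_le_of_ne h fun e => hrk ⟨x, e⟩⟩
    rw [this]
    exact isClosed_le hkc continuous_const
  · have h0 : f x = 0 := hx
    simp [hk, h0, hr.1]
  · refine disjoint_left.2 fun x hx hlt => ?_
    have h0 : g x = 0 := hx
    have h1 := hne x
    rw [h0, abs_zero, add_zero] at h1
    simp only [hk, mem_ofPred_eq, h0, abs_zero, add_zero, div_self h1] at hlt
    exact hlt.not_gt hr.2

lemma exists_disjoint_not_countable {α : Type*} {W : Set α} (hW : ¬W.Countable) :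
    ∃ s ⊆ W, ∃ t ⊆ W, Disjoint s t ∧ ¬s.Countable ∧ ¬t.Countable := by
  have hinf : W.Infinite := fun h => hW h.countable
  obtain ⟨s, t, rfl, hd, hc⟩ := hinf.exists_union_disjoint_cardinal_eq_of_infinite
  have hst : s.Countable ↔ t.Countable := by
    rw [← Cardinal.le_aleph0_iff_set_countable, ← Cardinal.le_aleph0_iff_set_countable, hc]
  rw [countable_union, ← hst, and_self] at hW
  exact ⟨s, subset_union_left, t, subset_union_right, hd, hW, hst.not.1 hW⟩

theorem IsQfSpace.countable (hQ : IsQfSpace X) (hX : IsPseudocompactSpace X) : Countable X := by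
  rw [← countable_univ_iff]
  by_contra huniv
  obtain ⟨W, hW, hWs⟩ := hQ.exists_unsplittable hX huniv
  obtain ⟨s, hsW, t, htW, hd, hs, ht⟩ := exists_disjoint_not_countable hW
  obtain ⟨Z, hZs, hZ, hZc⟩ := hQ.exists_uncountable_isZeroSet hs
  obtain ⟨Z', hZt, hZ', hZc'⟩ := hQ.exists_uncountable_isZeroSet ht
  obtain ⟨E, hE, hZE, hZE'⟩ := hQ.exists_isClopen_separating hX hZ hZ' (hd.mono hZs hZt)
  rcases hWs E hE with h | h
  · exact hZc (h.mono (subset_inter (hZs.trans hsW) hZE))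
  · exact hZc' (h.mono (subset_sdiff.2 ⟨hZt.trans htW, hZE'⟩))

end QfSpaces

section CountablePseudocompact

open Set Filter Topology

variable {X : Type*} [TopologicalSpace X]

lemma exists_continuous_injective_of_countable [T35Space X] [Countable X] :
    ∃ h : X → (X × X → ℝ), Continuous h ∧ Function.Injective h := by
  have hsep : ∀ p : X × X, ∃ f : X → ℝ, Continuous f ∧ (p.1 ≠ p.2 → f p.1 ≠ f p.2) := by
    intro p
    by_cases hp : p.1 = p.2
    · exact ⟨fun _ => 0, continuous_const, fun h => (h hp).elim⟩
    · obtain ⟨f, hf, hne⟩ := separatesPoints_continuous_of_t35Space hp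
      exact ⟨f, hf, fun _ => hne⟩
  choose f hf hne using hsep
  refine ⟨fun x p => f p x, continuous_pi hf, fun x y hxy => ?_⟩
  by_contra hn
  exact hne (x, y) hn (congrFun hxy (x, y))

lemma IsPseudocompactSpace.exists_tendsto_ultrafilter (hX : IsPseudocompactSpace X)
    (U : Ultrafilter X) {f : X → ℝ} (hf : Continuous f) : ∃ t, Tendsto f U (𝓝 t) := by
  obtain ⟨C, hC⟩ := hX f hf
  obtain ⟨t, -, ht⟩ := (isCompact_Icc (a := -C) (b := C)).ultrafilter_le_nhds' (U.map f)
    (Ultrafilter.mem_map.2 (univ_mem' fun x => abs_le.1 (hC x)))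
  exact ⟨t, ht⟩

/-- A pseudocompact Tychonoff space with a continuous injection into a countable power of the
line is compact. -/
lemma compactSpace_of_continuous_injective [T35Space X] (hX : IsPseudocompactSpace X)
    {ι : Type*} [Countable ι] {h : X → ι → ℝ} (hh : Continuous h) (hi : Function.Injective h) :
    CompactSpace X := by
  let := TopologicalSpace.metrizableSpaceMetric (ι → ℝ)
  refine ⟨isCompact_iff_ultrafilter_le_nhds.2 fun U _ => ?_⟩
  choose q hq using fun i => hX.exists_tendsto_ultrafilter U ((continuous_apply i).comp hh)
  have hq' : Tendsto h U (𝓝 q) := tendsto_pi_nhds.2 hq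
  obtain ⟨x, hx⟩ := (isClosed_range_of_isPseudocompactSpace hX hh).mem_of_tendsto hq'
    (Eventually.of_forall mem_range_self)
  refine ⟨x, mem_univ x, ?_⟩
  -- The closed range of `(h, f)` contains the joint limit; injectivity of `h` forces it to be
  -- attained at `x`.
  have hlim : ∀ f : X → ℝ, Continuous f → Tendsto f U (𝓝 (f x)) := by
    intro f hf
    obtain ⟨t, ht⟩ := hX.exists_tendsto_ultrafilter U hf
    obtain ⟨y, hy⟩ := (isClosed_range_of_isPseudocompactSpace hX (hh.prodMk hf)).mem_of_tendsto
      (hq'.prodMk_nhds ht) (Eventually.of_forall mem_range_self)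
    obtain ⟨hy1, hy2⟩ := Prod.ext_iff.1 hy
    obtain rfl : y = x := hi (hy1.trans hx.symm)
    exact (show f y = t from hy2) ▸ ht
  intro V hV
  obtain ⟨O, hOV, hO, hxO⟩ := mem_nhds_iff.1 hV
  obtain ⟨f, hf, hfx, hfO⟩ := CompletelyRegularSpace.completely_regular x Oᶜ hO.isClosed_compl
    (not_not.2 hxO)
  have hev := (hlim (fun y => (f y : ℝ)) (continuous_subtype_val.comp hf)).eventually
    (gt_mem_nhds (show (f x : ℝ) < 1 by rw [hfx]; norm_num))
  filter_upwards [hev] with y hy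
  refine hOV (by_contra fun hyO => ?_)
  rw [hfO hyO] at hy
  simp at hy

theorem metrizableSpace_and_compactSpace_of_countable [T35Space X] [Countable X]
    (hX : IsPseudocompactSpace X) : TopologicalSpace.MetrizableSpace X ∧ CompactSpace X := by
  obtain ⟨h, hh, hi⟩ := exists_continuous_injective_of_countable (X := X)
  have := compactSpace_of_continuous_injective hX hh hi
  exact ⟨(hh.isClosedEmbedding hi).isEmbedding.metrizableSpace, this⟩

end CountablePseudocompact

section CountableMetrizable

open Set

variable {X : Type*} [TopologicalSpace X]

lemma isZeroSet_empty : IsZeroSet (∅ : Set X) :=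
  ⟨fun _ => 1, continuous_const, by ext; simp⟩

lemma isZeroSet_singleton [TopologicalSpace.MetrizableSpace X] (x : X) :
    IsZeroSet ({x} : Set X) := by
  let := TopologicalSpace.metrizableSpaceMetric X
  exact ⟨fun y => dist y x, continuous_id.dist continuous_const, by ext; simp⟩

lemma isZerSigma_of_countable [TopologicalSpace.MetrizableSpace X] {A : Set X}
    (hA : A.Countable) : IsZerSigma A := by
  rcases A.eq_empty_or_nonempty with rfl | hne
  · exact ⟨fun _ => ∅, fun _ => isZeroSet_empty, by simp⟩
  · obtain ⟨u, rfl⟩ := hA.exists_eq_range hne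
    exact ⟨fun n => {u n}, fun n => isZeroSet_singleton _, (iUnion_singleton_eq_range u).symm⟩

lemma IsZerSigma.isCozDelta_compl {A : Set X} (hA : IsZerSigma A) : IsCozDelta Aᶜ := by
  obtain ⟨Z, hZ, rfl⟩ := hA
  exact ⟨fun n => (Z n)ᶜ, fun n => ⟨Z n, hZ n, rfl⟩, compl_iUnion Z⟩

theorem isQfSpace_of_countable_of_metrizableSpace [Countable X]
    [TopologicalSpace.MetrizableSpace X] : IsQfSpace X := fun A =>
  ⟨isZerSigma_of_countable A.to_countable,
    compl_compl A ▸ (isZerSigma_of_countable Aᶜ.to_countable).isCozDelta_compl⟩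

end CountableMetrizable

theorem proposition2p18 (X : Type*) [TopologicalSpace X] [T35Space X]
    (hX : IsPseudocompactSpace X) :
    IsQfSpace X ↔
      Countable X ∧ TopologicalSpace.MetrizableSpace X ∧ CompactSpace X := by
  constructor
  · intro hQ
    have := hQ.countable hX
    exact ⟨this, metrizableSpace_and_compactSpace_of_countable hX⟩
  · rintro ⟨_, _, _⟩
    exact isQfSpace_of_countable_of_metrizableSpace
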